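/- Let $\mathcal H$ be a complex Hilbert space and let $S(t)$, $t\ge 0$, be a strongly continuous semigroup of bounded operators on $\mathcal H$ with $S(0)=I$ and generator $A$. Assume that the half-plane $\{\operatorname{Re} z>0\}$ is contained in the resolvent set of $A$ and that $$\sup_{\operatorname{Re} z>0}\|(z-A)^{-1}\|=1$$ (that is, $\omega=0$ and $r(\omega)=1$, where $1/r(\omega):=\sup_{\operatorname{Re} z>\omega}\|(z-A)^{-1}\|$). Let $m:[0,\infty)\to(0,\infty)$ be a continuous function (for instance, a function of class $C^1$) such that $\|S(t)\|\le m(t)$ for all $t\ge 0$. Let $a,b>0$ and put $$I(a)=\inf_u\int_0^a m(s)^2\,\bigl(u'(s)^2-u(s)^2\bigr)_+\,ds,\qquad J(b)=\sup_\theta\int_0^b \frac{1}{m(s)^2}\,\bigl(\theta(s)^2-\theta'(s)^2\bigr)\,ds,$$ where $x_+=\max(x,0)$, the infimum is over all real-valued $u\in H^1(]0,a[)$ with $u(0)=0$ and $u(a)=1$, and the supremum is over all real-valued $\theta\in H^1(]0,b[)$ with $\theta(b)=1$ and $|\theta'|\le\theta$ almost everywhere on $]0,b[$. Then $I(a)$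 and $J(b)$ are finite, $J(b)>0$, and for all $t\ge a+b$, $$\|S(t)\|\le e^{-(t-a-b)}\,\frac{I(a)^{1/2}}{J(b)^{1/2}}.$$ -/

import Mathlib

open Set Filter Topology MeasureTheory
open scoped ContDiff ENNReal

noncomputable section

namespace SemigroupBound

/-! ### Strongly continuous semigroups, their generators and resolvents -/

section Semigroup

variable {H : Type*} [NormedAddCommGroup H] [InnerProductSpace ℂ H]

/-- `S` is a strongly continuous semigroup of bounded operators on `H`, indexed by `[0, ∞)`.
(`S` is a function on all of `ℝ`, but its values at negative times are never used.) -/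
structure IsC0Semigroup (S : ℝ → H →L[ℂ] H) : Prop where
  map_zero : S 0 = ContinuousLinearMap.id ℂ H
  map_add : ∀ s t : ℝ, 0 ≤ s → 0 ≤ t → S (s + t) = (S s).comp (S t)
  continuousOn : ∀ x : H, ContinuousOn (fun t : ℝ => S t x) (Ici 0)

/-- `(S(h) x - x) / h → y` as `h → 0⁺`. -/
def HasGenValue (S : ℝ → H →L[ℂ] H) (x y : H) : Prop :=
  Tendsto (fun h : ℝ => ((h⁻¹ : ℝ) : ℂ) • (S h x - x)) (𝓝[>] 0) (𝓝 y)

theorem HasGenValue.add {S : ℝ → H →L[ℂ] H} {x x' y y' : H}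
    (h : HasGenValue S x y) (h' : HasGenValue S x' y') :
    HasGenValue S (x + x') (y + y') := by
  unfold HasGenValue at *
  refine (Tendsto.add h h').congr fun t => ?_
  rw [← smul_add, _root_.map_add]
  congr 1
  abel

theorem HasGenValue.smul {S : ℝ → H →L[ℂ] H} {x y : H} (c : ℂ)
    (h : HasGenValue S x y) : HasGenValue S (c • x) (c • y) := by
  unfold HasGenValue at *
  refine (Tendsto.const_smul h c).congr fun t => ?_
  rw [_root_.map_smul, ← smul_sub, smul_comm]

theorem HasGenValue.unique {S : ℝ → H →L[ℂ] H} {x y y' : H}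
    (h : HasGenValue S x y) (h' : HasGenValue S x y') : y = y' :=
  tendsto_nhds_unique h h'

/-- The infinitesimal generator `A` of `S`: its domain is the set of all `x` for which
`(S(h) x - x) / h` converges as `h → 0⁺`, and `A x` is the limit. -/
def generator (S : ℝ → H →L[ℂ] H) : H →ₗ.[ℂ] H where
  domain :=
    { carrier := {x | ∃ y, HasGenValue S x y}
      add_mem' := fun ⟨y, hy⟩ ⟨y', hy'⟩ => ⟨y + y', hy.add hy'⟩
      zero_mem' := ⟨0, by simp [HasGenValue]⟩
      smul_mem' := fun c _ ⟨y, hy⟩ => ⟨c • y, hy.smul c⟩ }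
  toFun :=
    { toFun := fun x => Classical.choose x.2
      map_add' := fun x x' => (Classical.choose_spec (x + x').2).unique
        ((Classical.choose_spec x.2).add (Classical.choose_spec x'.2))
      map_smul' := fun c x => (Classical.choose_spec (c • x).2).unique
        ((Classical.choose_spec x.2).smul c) }

theorem hasGenValue_generator (S : ℝ → H →L[ℂ] H) (x : (generator S).domain) :
    HasGenValue S (x : H) (generator S x) :=
  Classical.choose_spec x.2

/-- The bounded operator `R` is the resolvent `(z - A)⁻¹` of the unbounded operator `A`:
it maps `H` into the domain of `A` and is a two-sided inverse of `z - A`. -/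
structure IsResolventAt (A : H →ₗ.[ℂ] H) (z : ℂ) (R : H →L[ℂ] H) : Prop where
  right_inv : ∀ x : H, ∃ hx : R x ∈ A.domain, z • R x - A ⟨R x, hx⟩ = x
  left_inv : ∀ x : A.domain, R (z • (x : H) - A x) = x

/-- `r(w) = r`, i.e. the open half-plane `Re z > w` lies in the resolvent set of `A` and
`1 / r = sup_{Re z > w} ‖(z - A)⁻¹‖`, with `0 < r < ∞`. -/
structure IsResolventRate (A : H →ₗ.[ℂ] H) (w r : ℝ) : Prop where
  pos : 0 < r
  exists_resolvent : ∀ z : ℂ, w < z.re → ∃ R : H →L[ℂ] H, IsResolventAt A z R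
  isLUB : IsLUB {c : ℝ | ∃ (z : ℂ) (R : H →L[ℂ] H),
    w < z.re ∧ IsResolventAt A z R ∧ c = ‖R‖} (1 / r)

end Semigroup

/-! ### The Sobolev space `H¹(]0,a[)` and the two variational problems -/

/-- `u' = g` on `]0,a[` in the sense of distributions. -/
def HasWeakDeriv (a : ℝ) (u g : ℝ → ℝ) : Prop :=
  ∀ φ : ℝ → ℝ, ContDiff ℝ ∞ φ → HasCompactSupport φ → tsupport φ ⊆ Ioo 0 a →
    ∫ s in Ioo 0 a, u s * deriv φ s = -∫ s in Ioo 0 a, g s * φ s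

/-- `u` is (the continuous representative on `[0,a]` of) a real-valued function in
`H¹(]0,a[)`, with weak derivative `u' = g`. By continuity `u 0` and `u a` are the boundary
values of `u`. -/
structure IsH1 (a : ℝ) (u g : ℝ → ℝ) : Prop where
  continuousOn : ContinuousOn u (Icc 0 a)
  memLp : MemLp u 2 (volume.restrict (Ioo 0 a))
  memLp_deriv : MemLp g 2 (volume.restrict (Ioo 0 a))
  weakDeriv : HasWeakDeriv a u g

/-- The values `∫₀ᵃ m² (u'² - u²)₊ ds` for `u ∈ H¹(]0,a[)` with `u(0) = 0`, `u(a) = 1`. -/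
def infValues (m : ℝ → ℝ) (a : ℝ) : Set ℝ :=
  {c | ∃ u u' : ℝ → ℝ, IsH1 a u u' ∧ u 0 = 0 ∧ u a = 1 ∧
    c = ∫ s in Ioo 0 a, m s ^ 2 * max (u' s ^ 2 - u s ^ 2) 0}

/-- The values `∫₀ᵇ m⁻² (θ² - θ'²) ds` for `θ ∈ H¹(]0,b[)` with `θ(b) = 1` and
`|θ'| ≤ θ` almost everywhere. -/
def supValues (m : ℝ → ℝ) (b : ℝ) : Set ℝ :=
  {c | ∃ θ θ' : ℝ → ℝ, IsH1 b θ θ' ∧ θ b = 1 ∧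
    (∀ᵐ s ∂(volume.restrict (Ioo 0 b)), |θ' s| ≤ θ s) ∧
    c = ∫ s in Ioo 0 b, 1 / m s ^ 2 * (θ s ^ 2 - θ' s ^ 2)}

end SemigroupBound

end

/-!
Let `χ(0) = 0`. The function `s ↦ χ(s) S(s) x` solves `(∂ₛ - A) v = χ'(s) S(s) x` with `v(0) = 0`, so
its Fourier-Laplace transform on a line `Re z = γ` is `(z - A)⁻¹` applied to that of `χ' S x`. The
resolvent has norm at most `1` there, and Plancherel's theorem gives the energy inequality
`∫ e^{-2γs} χ² ‖S(s) x‖² ≤ ∫ e^{-2γs} χ'² ‖S(s) x‖²` (`integral_energy_nonneg`).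

For competitors `u` and `θ` of the two variational problems, let `χ` be `u` on `[0,a]`, `e^{s-a}` on
`[a,t-b]` and `e^{t-a-b} θ(t-s)` on `[t-b,t]`. The middle interval does not contribute to
`∫ (χ'² - χ²) e^{-2γs} ‖S(s) x‖²`. On the first one `‖S(s) x‖ ≤ m(s) ‖x‖`, and on the last one
`‖S(t) x‖ ≤ m(t-s) ‖S(s) x‖`, which leads to
`e^{2(t-a-b)} e^{-2γt} ‖S(t)‖² ∫ m⁻² (θ² - θ'²) ≤ ∫ m² (u'² - u²)₊` (`exp_mul_norm_sq_mul_le`).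
The theorem follows by letting `γ → 0` and optimizing over `u` and `θ`.

The Laplace transform is known to converge only for `γ` above the exponential growth rate of `S`,
while the hypothesis concerns all `γ > 0`. The inequality itself closes this gap: applied with
`γ = l + 1/2` to a semigroup of growth rate `l ≥ 0`, it shows that the growth rate is at most
`l - 1/2`. After finitely many steps the semigroup is seen to be bounded (`exists_bound`).

Two facts about function spaces are needed on the way: on `L¹ ∩ L²` the Fourier integral is
isometric for the `L²` norm (`eLpNorm_fourier_eq`), and a function in `H¹` of an interval is the
primitive of its weak derivative (`IsH1.eq_add_integral`).
-/

namespace SemigroupBound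

/-! ### Plancherel's theorem for integrable square-integrable functions -/

section Plancherel

open FourierTransform SchwartzMap

/-- Mathlib defines the Fourier transform on `L²` by extension from Schwartz functions. On
`L¹ ∩ L²` it agrees with the Fourier integral, because both represent the Fourier transform in the
sense of tempered distributions. -/
theorem coeFn_fourier_toLp {E F : Type*} [NormedAddCommGroup E] [InnerProductSpace ℝ E]
    [FiniteDimensional ℝ E] [MeasurableSpace E] [BorelSpace E]
    [NormedAddCommGroup F] [InnerProductSpace ℂ F] [CompleteSpace F] {f : E → F}
    (hf : Integrable f) (hf2 : MemLp f 2) :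
    ((𝓕 (hf2.toLp f) : Lp F 2 (volume : Measure E)) : E → F) =ᵐ[volume] 𝓕 f := by
  have hcont : Continuous (𝓕 f) :=
    VectorFourier.fourierIntegral_continuous Real.continuous_fourierChar
      (by exact continuous_inner) hf
  refine ae_eq_of_integral_contDiff_smul_eq
    ((Lp.memLp _).locallyIntegrable one_le_two)
    hcont.locallyIntegrable fun g hg hgc => ?_
  have hgc' : HasCompactSupport (fun x => (g x : ℂ)) := hgc.comp_left (g := Complex.ofReal) rfl
  have hg' : ContDiff ℝ ∞ (fun x => (g x : ℂ)) := Complex.ofRealCLM.contDiff.comp hg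
  let φ : 𝓢(E, ℂ) := hgc'.toSchwartzMap hg'
  have hφ : ∀ x, φ x = (g x : ℂ) := fun x => rfl
  have h1 := congrArg (fun T : 𝓢'(E, F) => T φ) (Lp.fourier_toTemperedDistribution_eq (hf2.toLp f))
  simp only [TemperedDistribution.fourier_apply, Lp.toTemperedDistribution_apply] at h1
  have h2 : ∫ x, (𝓕 φ) x • f x = ∫ x, φ x • (𝓕 f) x := by
    have h := VectorFourier.integral_fourierIntegral_smul_eq_flip (L := innerₗ E)
      (μ := volume) (ν := volume) Real.continuous_fourierChar (by exact continuous_inner)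
      φ.integrable hf
    rw [flip_innerₗ] at h
    exact h
  have h3 : ∫ x, (𝓕 φ) x • (hf2.toLp f : E → F) x = ∫ x, (𝓕 φ) x • f x :=
    integral_congr_ae (hf2.coeFn_toLp.mono fun x hx => by simp only [hx])
  rw [h3, h2] at h1
  simpa only [hφ, Complex.coe_smul] using h1.symm

theorem eLpNorm_fourier_eq {E F : Type*} [NormedAddCommGroup E] [InnerProductSpace ℝ E]
    [FiniteDimensional ℝ E] [MeasurableSpace E] [BorelSpace E]
    [NormedAddCommGroup F] [InnerProductSpace ℂ F] [CompleteSpace F] {f : E → F}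
    (hf : Integrable f) (hf2 : MemLp f 2) :
    eLpNorm (𝓕 f) 2 volume = eLpNorm f 2 volume := by
  have h := Lp.norm_fourier_eq (hf2.toLp f)
  rw [Lp.norm_def, Lp.norm_def,
    ENNReal.toReal_eq_toReal_iff' (Lp.eLpNorm_ne_top _) (Lp.eLpNorm_ne_top _),
    eLpNorm_congr_ae (coeFn_fourier_toLp hf hf2), eLpNorm_congr_ae hf2.coeFn_toLp] at h
  exact h

end Plancherel

/-! ### Functions in `H¹` of an interval -/

/-- A test function of mean zero on `]0,a[` is the derivative of a test function. -/
theorem exists_primitive_of_integral_eq_zero {a : ℝ} {ψ : ℝ → ℝ} (hψ : ContDiff ℝ ∞ ψ)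
    (hc : HasCompactSupport ψ) (hs : tsupport ψ ⊆ Ioo 0 a) (h0 : ∫ s, ψ s = 0) :
    ∃ φ : ℝ → ℝ, ContDiff ℝ ∞ φ ∧ HasCompactSupport φ ∧ tsupport φ ⊆ Ioo 0 a ∧ deriv φ = ψ := by
  obtain ⟨c, d, hcd⟩ : ∃ c d : ℝ, 0 < c ∧ d < a ∧ tsupport ψ ⊆ Icc c d := by
    rcases (tsupport ψ).eq_empty_or_nonempty with he | hne
    · exact ⟨1, a - 1, one_pos, by linarith, by simp [he]⟩
    · obtain ⟨c, hc1, hc2⟩ := hc.exists_isLeast hne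
      obtain ⟨d, hd1, hd2⟩ := hc.exists_isGreatest hne
      exact ⟨c, d, (hs hc1).1, (hs hd1).2, fun x hx => ⟨hc2 hx, hd2 hx⟩⟩
  obtain ⟨hc0, hda, hsub⟩ := hcd
  have hz : ∀ x, x ∉ Icc c d → ψ x = 0 := fun x hx =>
    image_eq_zero_of_notMem_tsupport fun h => hx (hsub h)
  have hint : Integrable ψ := hψ.continuous.integrable_of_hasCompactSupport hc
  let φ : ℝ → ℝ := fun x => ∫ s in Iic x, ψ s
  have hφeq : ∀ x, φ x = φ 0 + ∫ s in (0 : ℝ)..x, ψ s := fun x => by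
    have := intervalIntegral.integral_Iic_sub_Iic (a := 0) (b := x) hint.integrableOn
      hint.integrableOn
    simp only [φ]; linarith
  have hder : ∀ x, HasDerivAt φ (ψ x) x := fun x => by
    have : φ = fun x => φ 0 + ∫ s in (0 : ℝ)..x, ψ s := funext hφeq
    rw [this]
    exact (intervalIntegral.integral_hasDerivAt_right (hψ.continuous.intervalIntegrable _ _)
      (hψ.continuous.stronglyMeasurableAtFilter _ _)
      hψ.continuous.continuousAt).const_add _
  have hd : deriv φ = ψ := funext fun x => (hder x).deriv
  have hsupp : Function.support φ ⊆ Icc c d := by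
    intro x hx
    by_contra hxn
    apply hx
    rcases lt_or_ge x c with h | h
    · exact setIntegral_eq_zero_of_forall_eq_zero fun y hy => hz y fun h' =>
        absurd (le_trans h'.1 hy) (not_le.2 h)
    · have hxd : d < x := not_le.1 fun h' => hxn ⟨h, h'⟩
      simp only [φ]
      rw [setIntegral_eq_integral_of_forall_compl_eq_zero, h0]
      exact fun y hy => hz y fun h' => hy (h'.2.trans hxd.le)
  have hts : tsupport φ ⊆ Icc c d := closure_minimal hsupp isClosed_Icc
  refine ⟨φ, ?_, HasCompactSupport.of_support_subset_isCompact isCompact_Icc hsupp,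
    hts.trans fun x hx => ⟨hc0.trans_le hx.1, hx.2.trans_lt hda⟩, hd⟩
  exact contDiff_infty_iff_deriv.2 ⟨fun x => (hder x).differentiableAt, by rwa [hd]⟩

/-- The lemma of du Bois-Reymond. -/
theorem exists_const_of_integral_mul_deriv_eq_zero {a : ℝ} (ha : 0 < a) {w : ℝ → ℝ}
    (hw : ContinuousOn w (Icc 0 a))
    (h : ∀ φ : ℝ → ℝ, ContDiff ℝ ∞ φ → HasCompactSupport φ → tsupport φ ⊆ Ioo 0 a →
      ∫ s in Ioo 0 a, w s * deriv φ s = 0) :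
    ∃ c, ∀ s ∈ Icc 0 a, w s = c := by
  -- a bump function `η` with integral `1`
  let f : ContDiffBump (a / 2) := ⟨a / 8, a / 4, by linarith, by linarith⟩
  let η : ℝ → ℝ := f.normed volume
  have hη1 : ∫ s, η s = 1 := f.integral_normed
  have hηc : HasCompactSupport η := f.hasCompactSupport_normed
  have hηd : ContDiff ℝ ∞ η := f.contDiff_normed
  have hηs : tsupport η ⊆ Ioo 0 a := by
    rw [f.tsupport_normed_eq, Real.closedBall_eq_Icc]
    intro x hx
    simp only [f, mem_Icc] at hx
    constructor <;> linarith [hx.1, hx.2]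
  have hIw : ∀ ψ : ℝ → ℝ, Continuous ψ → IntegrableOn (fun s => w s * ψ s) (Ioo 0 a) :=
    fun ψ hψ => ((hw.mul hψ.continuousOn).integrableOn_Icc).mono_set Ioo_subset_Icc_self
  let c := ∫ s in Ioo 0 a, w s * η s
  have hae : ∀ᵐ s, s ∈ Ioo 0 a → w s - c = 0 := by
    refine isOpen_Ioo.ae_eq_zero_of_integral_contDiff_smul_eq_zero ?_ fun ψ hψ hψc hψs => ?_
    · exact ((hw.mono Ioo_subset_Icc_self).sub continuousOn_const).locallyIntegrableOn
        measurableSet_Ioo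
    have hψint : Integrable ψ := hψ.continuous.integrable_of_hasCompactSupport hψc
    have hηint : Integrable η := hηd.continuous.integrable_of_hasCompactSupport hηc
    obtain ⟨φ, h1, h2, h3, h4⟩ := exists_primitive_of_integral_eq_zero (a := a)
      (ψ := fun s => ψ s - (∫ r, ψ r) * η s) (hψ.sub (contDiff_const.mul hηd))
      (hψc.sub hηc.mul_left)
      ((tsupport_sub _ _).trans (union_subset hψs ((tsupport_mul_subset_right).trans hηs)))
      (by rw [integral_sub hψint (hηint.const_mul _), integral_const_mul, hη1]; ring)
    have h5 := h φ h1 h2 h3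
    rw [h4] at h5
    have hzero : ∀ s, s ∉ Ioo 0 a → ψ s • (w s - c) = 0 := fun s hs => by
      rw [image_eq_zero_of_notMem_tsupport fun h' => hs (hψs h'), zero_smul]
    have h6 : ∫ s in Ioo 0 a, ψ s = ∫ s, ψ s :=
      setIntegral_eq_integral_of_forall_compl_eq_zero fun s hs =>
        image_eq_zero_of_notMem_tsupport fun h' => hs (hψs h')
    rw [← setIntegral_eq_integral_of_forall_compl_eq_zero hzero]
    have h7 : ∫ s in Ioo 0 a, ψ s • (w s - c) =
        (∫ s in Ioo 0 a, w s * ψ s) - ∫ s in Ioo 0 a, c * ψ s := by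
      rw [← integral_sub (hIw ψ hψ.continuous) (hψint.integrableOn.const_mul _)]
      exact integral_congr_ae (ae_of_all _ fun s => by simp only [smul_eq_mul]; ring)
    have h8 : ∫ s in Ioo 0 a, w s * (ψ s - (∫ r, ψ r) * η s) =
        (∫ s in Ioo 0 a, w s * ψ s) - (∫ r, ψ r) * c := by
      rw [← integral_const_mul, ← integral_sub (hIw ψ hψ.continuous)
        ((hIw η hηd.continuous).const_mul _)]
      exact integral_congr_ae (ae_of_all _ fun s => by simp only; ring)
    rw [h7, integral_const_mul, h6]
    rw [h8] at h5
    linarith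
  refine ⟨c, ?_⟩
  have heq : EqOn w (fun _ => c) (Ioo 0 a) :=
    Measure.eqOn_open_of_ae_eq (μ := volume)
      (by
        rw [Filter.EventuallyEq, ae_restrict_iff' measurableSet_Ioo]
        filter_upwards [hae] with s hs h' using sub_eq_zero.1 (hs h'))
      isOpen_Ioo (hw.mono Ioo_subset_Icc_self) continuousOn_const
  have := heq.of_subset_closure hw continuousOn_const Ioo_subset_Icc_self
    (closure_Ioo ha.ne).ge
  exact this

theorem IsH1.integrableOn_deriv {a : ℝ} {u g : ℝ → ℝ} (h : IsH1 a u g) :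
    IntegrableOn g (Ioo 0 a) := h.memLp_deriv.integrable one_le_two

/-- Functions in `H¹(]0,a[)` are absolutely continuous. -/
theorem IsH1.eq_add_integral {a : ℝ} (ha : 0 < a) {u g : ℝ → ℝ} (h : IsH1 a u g) {s : ℝ}
    (hs : s ∈ Icc 0 a) : u s = u 0 + ∫ r in (0 : ℝ)..s, g r := by
  have hg : IntervalIntegrable g volume 0 a := by
    rw [intervalIntegrable_iff_integrableOn_Ioo_of_le ha.le]
    exact h.integrableOn_deriv
  let G : ℝ → ℝ := fun s => ∫ r in (0 : ℝ)..s, g r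
  have hGac : AbsolutelyContinuousOnInterval G 0 a :=
    hg.absolutelyContinuousOnInterval_intervalIntegral left_mem_uIcc
  have hGc : ContinuousOn G (Icc 0 a) := by
    have := hGac.continuousOn
    rwa [uIcc_of_le ha.le] at this
  obtain ⟨c, hc⟩ := exists_const_of_integral_mul_deriv_eq_zero ha
    (w := fun s => u s - G s) (h.continuousOn.sub hGc) fun φ h1 h2 h3 => by
      have hφc : Continuous (deriv φ) := h1.continuous_deriv (by simp)
      have hφ0 : φ 0 = 0 := image_eq_zero_of_notMem_tsupport fun h' => lt_irrefl _ (h3 h').1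
      have hφa : φ a = 0 := image_eq_zero_of_notMem_tsupport fun h' => lt_irrefl _ (h3 h').2
      have hφac : AbsolutelyContinuousOnInterval φ 0 a :=
        ContDiffOn.absolutelyContinuousOnInterval ((h1.of_le (by simp)).contDiffOn)
      have e1 := hGac.integral_mul_deriv_eq_deriv_mul hφac
      have e2 : ∫ x in (0 : ℝ)..a, deriv G x * φ x = ∫ x in (0 : ℝ)..a, g x * φ x := by
        refine intervalIntegral.integral_congr_ae ?_
        filter_upwards [hg.ae_hasDerivAt_integral] with x hx hx'
        rw [(hx (uIoc_subset_uIcc hx') 0 left_mem_uIcc).deriv]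
      rw [e2, hφ0, hφa, intervalIntegral.integral_of_le ha.le,
        intervalIntegral.integral_of_le ha.le, integral_Ioc_eq_integral_Ioo,
        integral_Ioc_eq_integral_Ioo] at e1
      have e3 := h.weakDeriv φ h1 h2 h3
      have i1 : IntegrableOn (fun s => u s * deriv φ s) (Ioo 0 a) :=
        ((h.continuousOn.mul hφc.continuousOn).integrableOn_Icc).mono_set Ioo_subset_Icc_self
      have i2 : IntegrableOn (fun s => G s * deriv φ s) (Ioo 0 a) :=
        ((hGc.mul hφc.continuousOn).integrableOn_Icc).mono_set Ioo_subset_Icc_self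
      simp only [sub_mul]
      rw [integral_sub i1 i2, e1, e3]
      ring
  have h0 := hc 0 ⟨le_rfl, ha.le⟩
  have h1 := hc s hs
  simp only [G, intervalIntegral.integral_same] at h0 h1
  linarith

/-- A continuously differentiable function lies in `H¹(]0,a[)`. -/
theorem isH1_of_hasDerivAt {a : ℝ} (ha : 0 < a) {u g : ℝ → ℝ} (hu : ∀ s, HasDerivAt u (g s) s)
    (hg : Continuous g) : IsH1 a u g := by
  have huc : Continuous u := continuous_iff_continuousAt.2 fun s => (hu s).continuousAt
  have hm : ∀ f : ℝ → ℝ, Continuous f → MemLp f 2 (volume.restrict (Ioo 0 a)) := fun f hf =>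
    (memLp_two_iff_integrable_sq hf.aestronglyMeasurable).2
      ((hf.pow 2).integrableOn_Icc.mono_set Ioo_subset_Icc_self)
  refine ⟨huc.continuousOn, hm u huc, hm g hg, fun φ h1 h2 h3 => ?_⟩
  have hφ0 : φ 0 = 0 := image_eq_zero_of_notMem_tsupport fun h' => lt_irrefl _ (h3 h').1
  have hφa : φ a = 0 := image_eq_zero_of_notMem_tsupport fun h' => lt_irrefl _ (h3 h').2
  have := intervalIntegral.integral_mul_deriv_eq_deriv_mul (a := 0) (b := a)
    (u := u) (v := φ) (u' := g) (v' := deriv φ) (fun x _ => hu x)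
    (fun x _ => (h1.differentiable (by simp) x).hasDerivAt) (hg.intervalIntegrable _ _)
    ((h1.continuous_deriv (by simp)).intervalIntegrable _ _)
  rw [hφ0, hφa, intervalIntegral.integral_of_le ha.le,
        intervalIntegral.integral_of_le ha.le, integral_Ioc_eq_integral_Ioo,
        integral_Ioc_eq_integral_Ioo] at this
  rw [this]; ring

/-! ### The resolvent as a Laplace transform of the semigroup -/

section Laplace

variable {H : Type*} [NormedAddCommGroup H] [InnerProductSpace ℂ H] {S : ℝ → H →L[ℂ] H}

theorem IsC0Semigroup.hasGenValue_apply (hS : IsC0Semigroup S) {x y : H} (h : HasGenValue S x y)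
    {t : ℝ} (ht : 0 ≤ t) : HasGenValue S (S t x) (S t y) := by
  unfold HasGenValue at *
  refine (((S t).continuous.tendsto y).comp h).congr' ?_
  filter_upwards [self_mem_nhdsWithin] with r hr
  have hr0 : 0 ≤ r := le_of_lt hr
  have e : S r (S t x) = S t (S r x) := by
    have h1 := congrArg (fun T : H →L[ℂ] H => T x) (hS.map_add r t hr0 ht)
    have h2 := congrArg (fun T : H →L[ℂ] H => T x) (hS.map_add t r ht hr0)
    simp only [ContinuousLinearMap.comp_apply] at h1 h2
    rw [← h1, ← h2, add_comm]
  simp only [Function.comp_apply, map_smul, map_sub, e]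

theorem IsResolventAt.apply_comm (hS : IsC0Semigroup S) {z : ℂ} {R : H →L[ℂ] H}
    (hR : IsResolventAt (generator S) z R) {t : ℝ} (ht : 0 ≤ t) (x : H) :
    R (S t x) = S t (R x) := by
  obtain ⟨hx, he⟩ := hR.right_inv x
  have h1 := hS.hasGenValue_apply (hasGenValue_generator S ⟨R x, hx⟩) ht
  have hmem : S t (R x) ∈ (generator S).domain := ⟨_, h1⟩
  have h2 := hR.left_inv ⟨S t (R x), hmem⟩
  rw [(hasGenValue_generator S ⟨_, hmem⟩).unique h1] at h2
  have h3 : S t x = z • S t (R x) - S t (generator S ⟨R x, hx⟩) := by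
    rw [← map_smul, ← map_sub, he]
  rw [h3]
  exact h2

theorem IsC0Semigroup.hasDerivWithinAt (hS : IsC0Semigroup S) {x y : H} (h : HasGenValue S x y)
    {t : ℝ} (ht : 0 ≤ t) : HasDerivWithinAt (fun s => S s x) (S t y) (Ioi t) t := by
  rw [hasDerivWithinAt_iff_tendsto_slope' (by simp)]
  have h1 : Tendsto (fun s : ℝ => s - t) (𝓝[>] t) (𝓝[>] 0) := by
    refine tendsto_nhdsWithin_iff.2 ⟨?_, ?_⟩
    · have : Tendsto (fun s : ℝ => s - t) (𝓝 t) (𝓝 (t - t)) :=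
        (continuous_id.sub continuous_const).tendsto t
      rw [sub_self] at this
      exact this.mono_left nhdsWithin_le_nhds
    · filter_upwards [self_mem_nhdsWithin] with s hs using mem_Ioi.2 (sub_pos.2 (mem_Ioi.1 hs))
  refine ((((S t).continuous.tendsto y).comp h).comp h1).congr' ?_
  filter_upwards [self_mem_nhdsWithin] with s hs
  have e : S s x = S t (S (s - t) x) := by
    have h2 := congrArg (fun T : H →L[ℂ] H => T x) (hS.map_add t (s - t) ht (sub_nonneg.2 (mem_Ioi.1 hs).le))
    rwa [add_sub_cancel] at h2
  simp only [Function.comp_apply, slope_def_module, e, map_smul, map_sub, ← Complex.coe_smul]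

theorem IsC0Semigroup.continuousOn_exp_smul (hS : IsC0Semigroup S) (z : ℂ) (x : H) :
    ContinuousOn (fun s : ℝ => Complex.exp (-z * s) • S s x) (Ici 0) :=
  (Continuous.continuousOn (by fun_prop)).smul (hS.continuousOn x)

/-- Decay of `e^{-zs} S(s) x` to the right of an exponential bound for the semigroup. -/
theorem norm_exp_smul_le {M l : ℝ} (hM : ∀ t : ℝ, 0 ≤ t → ‖S t‖ ≤ M * Real.exp (l * t))
    (z : ℂ) (x : H) {s : ℝ} (hs : 0 ≤ s) :
    ‖Complex.exp (-z * s) • S s x‖ ≤ M * ‖x‖ * Real.exp (-(z.re - l) * s) := by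
  rw [norm_smul, Complex.norm_exp]
  have h1 : (-z * (s : ℂ)).re = -z.re * s := by simp
  rw [h1]
  calc Real.exp (-z.re * s) * ‖S s x‖
      ≤ Real.exp (-z.re * s) * ((M * Real.exp (l * s)) * ‖x‖) := by
        gcongr
        exact ((S s).le_opNorm x).trans (by gcongr; exact hM s hs)
    _ = M * ‖x‖ * (Real.exp (-z.re * s) * Real.exp (l * s)) := by ring
    _ = _ := by rw [← Real.exp_add]; congr 2; ring

theorem integrableOn_exp_smul (hS : IsC0Semigroup S) {M l : ℝ}
    (hM : ∀ t : ℝ, 0 ≤ t → ‖S t‖ ≤ M * Real.exp (l * t)) {z : ℂ} (hz : l < z.re) (x : H) :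
    IntegrableOn (fun s : ℝ => Complex.exp (-z * s) • S s x) (Ioi 0) := by
  refine Integrable.mono' (g := fun s => M * ‖x‖ * Real.exp (-(z.re - l) * s))
    ((exp_neg_integrableOn_Ioi 0 (sub_pos.2 hz)).const_mul _) ?_ ?_
  · exact ((hS.continuousOn_exp_smul z x).mono Ioi_subset_Ici_self).aestronglyMeasurable
      measurableSet_Ioi
  · exact (ae_restrict_mem measurableSet_Ioi).mono fun s hs =>
      norm_exp_smul_le hM z x (le_of_lt hs)

variable [CompleteSpace H]

theorem integral_exp_smul (hS : IsC0Semigroup S) {z : ℂ} {R : H →L[ℂ] H}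
    (hR : IsResolventAt (generator S) z R) (x : H) {r T : ℝ} (hr : 0 ≤ r) (hT : r ≤ T) :
    ∫ s in r..T, Complex.exp (-z * s) • S s x =
      Complex.exp (-z * r) • S r (R x) - Complex.exp (-z * T) • S T (R x) := by
  obtain ⟨hx, he⟩ := hR.right_inv x
  have hsub : uIcc r T ⊆ Ici 0 := by
    rw [uIcc_of_le hT]; exact fun s hs => hr.trans hs.1
  have h := intervalIntegral.integral_eq_sub_of_hasDeriv_right (a := r) (b := T)
    (f := fun s : ℝ => -(Complex.exp (-z * s) • S s (R x)))
    (f' := fun s : ℝ => Complex.exp (-z * s) • S s x)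
    ((hS.continuousOn_exp_smul z (R x)).mono hsub).neg ?_
    ((hS.continuousOn_exp_smul z x).mono hsub).intervalIntegrable
  · rw [h]; abel
  · intro s hs
    rw [min_eq_left hT] at hs
    have hs0 : 0 ≤ s := hr.trans hs.1.le
    have h1 := hS.hasDerivWithinAt (hasGenValue_generator S ⟨R x, hx⟩) hs0
    have h2 : HasDerivWithinAt (fun s : ℝ => Complex.exp (-z * s))
        (Complex.exp (-z * s) * (-z)) (Ioi s) s := by
      have : HasDerivAt (fun s : ℝ => -z * (s : ℂ)) (-z) s := by
        simpa using (Complex.ofRealCLM.hasDerivAt (x := s)).const_mul (-z)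
      exact this.cexp.hasDerivWithinAt
    have h3 := (h2.smul h1).neg
    refine h3.congr_deriv ?_
    conv_rhs => rw [← he]
    simp only [map_sub, map_smul, smul_sub, smul_smul]
    rw [mul_neg, neg_smul]
    abel

theorem integral_Ioi_exp_smul (hS : IsC0Semigroup S) {M l : ℝ}
    (hM : ∀ t : ℝ, 0 ≤ t → ‖S t‖ ≤ M * Real.exp (l * t)) {z : ℂ} (hz : l < z.re)
    {R : H →L[ℂ] H} (hR : IsResolventAt (generator S) z R) (x : H) {r : ℝ} (hr : 0 ≤ r) :
    ∫ s in Ioi r, Complex.exp (-z * s) • S s x = Complex.exp (-z * r) • S r (R x) := by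
  have h1 := intervalIntegral_tendsto_integral_Ioi r
    ((integrableOn_exp_smul hS hM hz x).mono_set (Ioi_subset_Ioi hr)) tendsto_id
  refine tendsto_nhds_unique h1 ?_
  have h2 : Tendsto (fun T : ℝ => Complex.exp (-z * T) • S T (R x)) atTop (𝓝 0) := by
    refine squeeze_zero_norm' (a := fun T => M * ‖R x‖ * Real.exp (-(z.re - l) * T)) ?_ ?_
    · filter_upwards [eventually_ge_atTop 0] with T hT using norm_exp_smul_le hM z (R x) hT
    · have : Tendsto (fun T : ℝ => -(z.re - l) * T) atTop atBot :=
        tendsto_id.const_mul_atTop_of_neg (by linarith)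
      simpa using (Real.tendsto_exp_atBot.comp this).const_mul (M * ‖R x‖)
  have h3 := (tendsto_const_nhds (x := Complex.exp (-z * r) • S r (R x))).sub h2
  rw [sub_zero] at h3
  refine h3.congr' ?_
  filter_upwards [eventually_ge_atTop r] with T hT
  exact (integral_exp_smul hS hR x hr hT).symm

/-- The Laplace transform of the equation `(∂ₜ - A) (χ(t) S(t) x) = χ'(t) S(t) x`, where
`χ(0) = 0` and `χ' = h`. -/
theorem integral_primitive_exp_smul (hS : IsC0Semigroup S) {M l : ℝ}
    (hM : ∀ t : ℝ, 0 ≤ t → ‖S t‖ ≤ M * Real.exp (l * t)) {z : ℂ} (hz : l < z.re)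
    {R : H →L[ℂ] H} (hR : IsResolventAt (generator S) z R) (x : H) {h : ℝ → ℝ}
    (hh : Integrable h)
    (hint : IntegrableOn (fun s : ℝ => (h s : ℂ) • Complex.exp (-z * s) • S s x) (Ioi 0)) :
    ∫ s in Ioi (0 : ℝ), ((∫ r in (0 : ℝ)..s, h r : ℝ) : ℂ) • Complex.exp (-z * s) • S s x =
      R (∫ s in Ioi (0 : ℝ), (h s : ℂ) • Complex.exp (-z * s) • S s x) := by
  let v : ℝ → H := fun s => Complex.exp (-z * s) • S s x
  let μ : Measure ℝ := volume.restrict (Ioi 0)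
  have hv : Integrable v μ := integrableOn_exp_smul hS hM hz x
  have hhc : Integrable (fun r => (h r : ℂ)) μ := hh.ofReal.integrableOn
  have hK : Integrable (Function.uncurry fun r s : ℝ =>
      {p : ℝ × ℝ | p.1 ≤ p.2}.indicator (fun p => (h p.1 : ℂ) • v p.2) (r, s)) (μ.prod μ) :=
    (hhc.smul_prod hv).indicator (measurableSet_le measurable_fst measurable_snd)
  have hswap := integral_integral_swap hK
  have hL : ∀ r ∈ Ioi (0 : ℝ), ∫ s, {p : ℝ × ℝ | p.1 ≤ p.2}.indicator
      (fun p => (h p.1 : ℂ) • v p.2) (r, s) ∂μ =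
      R ((h r : ℂ) • Complex.exp (-z * r) • S r x) := by
    intro r hr
    have e1 : ∀ s, {p : ℝ × ℝ | p.1 ≤ p.2}.indicator (fun p => (h p.1 : ℂ) • v p.2) (r, s) =
        (Ici r).indicator (fun s => (h r : ℂ) • v s) s := fun s => by
      simp only [indicator, mem_ofPred_eq, mem_Ici]
    simp only [e1]
    rw [integral_indicator measurableSet_Ici, Measure.restrict_restrict measurableSet_Ici,
      inter_eq_left.2 (fun s hs => mem_Ioi.2 ((mem_Ioi.1 hr).trans_le (mem_Ici.1 hs))), integral_smul,
      integral_Ici_eq_integral_Ioi, integral_Ioi_exp_smul hS hM hz hR x (le_of_lt hr),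
      map_smul, map_smul, hR.apply_comm hS (le_of_lt hr)]
  have hRt : ∀ s ∈ Ioi (0 : ℝ), ∫ r, {p : ℝ × ℝ | p.1 ≤ p.2}.indicator
      (fun p => (h p.1 : ℂ) • v p.2) (r, s) ∂μ =
      ((∫ r in (0 : ℝ)..s, h r : ℝ) : ℂ) • Complex.exp (-z * s) • S s x := by
    intro s hs
    have e1 : ∀ r, {p : ℝ × ℝ | p.1 ≤ p.2}.indicator (fun p => (h p.1 : ℂ) • v p.2) (r, s) =
        (Iic s).indicator (fun r => (h r : ℂ) • v s) r := fun r => by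
      simp only [indicator, mem_ofPred_eq, mem_Iic]
    simp only [e1]
    rw [integral_indicator measurableSet_Iic, Measure.restrict_restrict measurableSet_Iic,
      inter_comm, Ioi_inter_Iic, integral_smul_const, intervalIntegral.integral_of_le
      (le_of_lt hs), integral_complex_ofReal]
  rw [setIntegral_congr_fun measurableSet_Ioi hL, setIntegral_congr_fun measurableSet_Ioi hRt]
    at hswap
  rw [← hswap]
  exact R.integral_comp_comm hint

end Laplace

/-! ### The energy inequality -/

section Energy

open FourierTransform

variable {H : Type*} [NormedAddCommGroup H] [InnerProductSpace ℂ H]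

/-- Plancherel's theorem turns a pointwise bound between Fourier transforms into a bound between
`L²` norms. -/
theorem integral_norm_sq_le_of_norm_fourier_le [CompleteSpace H] {f g : ℝ → H}
    (hf : Integrable f) (hf2 : MemLp f 2) (hg : Integrable g) (hg2 : MemLp g 2)
    (h : ∀ ξ, ‖𝓕 f ξ‖ ≤ ‖𝓕 g ξ‖) : ∫ s, ‖f s‖ ^ 2 ≤ ∫ s, ‖g s‖ ^ 2 := by
  have h1 : eLpNorm f 2 volume ≤ eLpNorm g 2 volume := by
    rw [← eLpNorm_fourier_eq hf hf2, ← eLpNorm_fourier_eq hg hg2]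
    exact eLpNorm_mono h
  rw [hf2.eLpNorm_eq_integral_rpow_norm two_ne_zero ENNReal.ofNat_ne_top,
    hg2.eLpNorm_eq_integral_rpow_norm two_ne_zero ENNReal.ofNat_ne_top] at h1
  have h2 := (ENNReal.ofReal_le_ofReal_iff (by positivity)).1 h1
  have h3 := (Real.rpow_le_rpow_iff (by positivity) (by positivity) (by simp)).1 h2
  simpa using h3

theorem fourier_indicator_Ioi (v : ℝ → H) (γ ξ : ℝ) :
    𝓕 ((Ioi (0 : ℝ)).indicator fun s => (Real.exp (-γ * s) : ℂ) • v s) ξ =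
      ∫ s in Ioi (0 : ℝ), Complex.exp (-(γ + 2 * Real.pi * ξ * Complex.I : ℂ) * s) • v s := by
  rw [Real.fourier_eq', ← integral_indicator measurableSet_Ioi]
  congr 1
  ext s
  by_cases hs : s ∈ Ioi (0 : ℝ)
  · rw [indicator_of_mem hs, indicator_of_mem hs, smul_smul, Complex.ofReal_exp, ← Complex.exp_add]
    congr 2
    simp
    ring
  · rw [indicator_of_notMem hs, indicator_of_notMem hs, smul_zero]

variable {S : ℝ → H →L[ℂ] H}

theorem norm_exp_mul_norm_le {M l : ℝ} (hM : ∀ t : ℝ, 0 ≤ t → ‖S t‖ ≤ M * Real.exp (l * t))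
    (γ : ℝ) (x : H) {s : ℝ} (hs : 0 ≤ s) :
    ‖(Real.exp (-γ * s) : ℂ) • S s x‖ ≤ M * ‖x‖ * Real.exp (-(γ - l) * s) := by
  have h := norm_exp_smul_le hM (γ : ℂ) x hs
  rw [Complex.ofReal_re] at h
  convert h using 4
  push_cast
  rfl

/-- The energy inequality: in the `L²` space with weight `e^{-2γs}` the inverse of `∂ₜ - A` has
norm at most `1`. It is applied to `χ(s) S(s) x` with `χ(0) = 0`, `χ' = h` on `[0,T]` and `χ`
constant on `[T,∞)`; the contribution of `[T,∞)` to `∫ e^{-2γs} χ² ‖S(s) x‖²` is dropped. -/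
theorem integral_energy_nonneg [CompleteSpace H] (hS : IsC0Semigroup S) {M l γ : ℝ}
    (hM : ∀ t : ℝ, 0 ≤ t → ‖S t‖ ≤ M * Real.exp (l * t)) (hγ : l < γ)
    (hR : ∀ z : ℂ, z.re = γ → ∃ R : H →L[ℂ] H, IsResolventAt (generator S) z R ∧ ‖R‖ ≤ 1)
    (x : H) {T : ℝ} (hT : 0 ≤ T) {h : ℝ → ℝ} (hh : MemLp h 2 (volume.restrict (Ioc 0 T))) :
    0 ≤ ∫ s in (0 : ℝ)..T, (h s ^ 2 - (∫ r in (0 : ℝ)..s, h r) ^ 2) *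
      (Real.exp (-γ * s) * ‖S s x‖) ^ 2 := by
  have hM0 : 0 ≤ M := by
    have := (norm_nonneg _).trans (hM 0 le_rfl)
    simpa using this
  let k : ℝ → ℝ := (Ioc 0 T).indicator h
  have hk2 : MemLp k 2 := (memLp_indicator_iff_restrict measurableSet_Ioc).2 hh
  have hk : Integrable k :=
    (integrable_indicator_iff measurableSet_Ioc).2 (hh.integrable one_le_two)
  let χ : ℝ → ℝ := fun s => ∫ r in (0 : ℝ)..s, k r
  have hχc : Continuous χ := intervalIntegral.continuous_primitive (fun _ _ => hk.intervalIntegrable) 0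
  have hχb : ∀ s, |χ s| ≤ ∫ r, |k r| := fun s =>
    (intervalIntegral.norm_integral_le_integral_norm_uIoc).trans
      (setIntegral_le_integral hk.norm (ae_of_all _ fun _ => norm_nonneg _))
  set C := ∫ r, |k r| with hC
  have hC0 : 0 ≤ C := integral_nonneg fun _ => abs_nonneg _
  let v : ℝ → H := fun s => (Real.exp (-γ * s) : ℂ) • S s x
  have hvc : ContinuousOn v (Ioi 0) := by
    refine (Continuous.continuousOn (by fun_prop)).smul
      ((hS.continuousOn x).mono Ioi_subset_Ici_self)
  have hvn : ∀ s, ‖v s‖ = Real.exp (-γ * s) * ‖S s x‖ := fun s => by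
    simp only [v, norm_smul, Complex.norm_real, Real.norm_eq_abs, Real.abs_exp]
  have hvm : AEStronglyMeasurable v (volume.restrict (Ioi 0)) :=
    hvc.aestronglyMeasurable measurableSet_Ioi
  have hvb : ∀ s ∈ Ioi (0 : ℝ), ‖v s‖ ≤ M * ‖x‖ * Real.exp (-(γ - l) * s) := fun s hs =>
    norm_exp_mul_norm_le hM γ x (le_of_lt hs)
  let w : ℝ → H := (Ioi (0 : ℝ)).indicator fun s => (χ s : ℂ) • v s
  let g : ℝ → H := (Ioi (0 : ℝ)).indicator fun s => (k s : ℂ) • v s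
  have hwm : AEStronglyMeasurable w := by
    refine (aestronglyMeasurable_indicator_iff measurableSet_Ioi).2 (AEStronglyMeasurable.smul ?_ hvm)
    exact (Complex.continuous_ofReal.comp hχc).aestronglyMeasurable
  have hgm : AEStronglyMeasurable g := by
    refine (aestronglyMeasurable_indicator_iff measurableSet_Ioi).2 (AEStronglyMeasurable.smul ?_ hvm)
    exact (hk.ofReal (𝕜 := ℂ)).aestronglyMeasurable.restrict
  have hwn : ∀ s, ‖w s‖ ≤ ‖(Ioi (0 : ℝ)).indicator
      (fun s => C * (M * ‖x‖) * Real.exp (-(γ - l) * s)) s‖ := fun s => by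
    by_cases hs : s ∈ Ioi (0 : ℝ)
    · simp only [w, indicator_of_mem hs, norm_smul, Complex.norm_real, Real.norm_eq_abs]
      rw [abs_of_nonneg (a := C * _ * _) (by positivity), mul_assoc]
      exact mul_le_mul (hχb s) (hvb s hs) (norm_nonneg _) hC0
    · simp [w, indicator_of_notMem hs]
  have hgn : ∀ s, ‖g s‖ ≤ M * ‖x‖ * ‖k s‖ := fun s => by
    by_cases hs : s ∈ Ioi (0 : ℝ)
    · simp only [g, indicator_of_mem hs, norm_smul, Complex.norm_real]
      rw [mul_comm]
      gcongr
      refine (hvb s hs).trans (mul_le_of_le_one_right (by positivity) (Real.exp_le_one_iff.2 ?_))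
      have : 0 ≤ (γ - l) * s := mul_nonneg (by linarith) (le_of_lt hs)
      linarith
    · simp only [g, indicator_of_notMem hs, norm_zero]
      positivity
  have hE1 : Integrable ((Ioi (0 : ℝ)).indicator
      (fun s => C * (M * ‖x‖) * Real.exp (-(γ - l) * s))) :=
    (integrable_indicator_iff measurableSet_Ioi).2
      ((exp_neg_integrableOn_Ioi 0 (sub_pos.2 hγ)).const_mul _)
  have hE2 : MemLp ((Ioi (0 : ℝ)).indicator
      (fun s => C * (M * ‖x‖) * Real.exp (-(γ - l) * s))) 2 := by
    rw [memLp_indicator_iff_restrict measurableSet_Ioi]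
    refine (memLp_two_iff_integrable_sq (by fun_prop)).2 ?_
    have := (exp_neg_integrableOn_Ioi 0 (b := 2 * (γ - l)) (by linarith)).const_mul
      ((C * (M * ‖x‖)) ^ 2)
    refine this.congr (ae_of_all _ fun s => ?_)
    simp only [mul_pow, ← Real.exp_nat_mul]
    congr 2
    push_cast
    ring
  have hw1 : Integrable w := hE1.mono hwm (ae_of_all _ hwn)
  have hw2 : MemLp w 2 := hE2.mono hwm (ae_of_all _ hwn)
  have hg1 : Integrable g := hk.norm.const_mul (M * ‖x‖) |>.mono' hgm (ae_of_all _ hgn)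
  have hg2 : MemLp g 2 := hk2.of_le_mul hgm (ae_of_all _ hgn)
  have hF : ∀ ξ, ‖𝓕 w ξ‖ ≤ ‖𝓕 g ξ‖ := fun ξ => by
    have e : ∀ p : ℝ → ℝ, (fun s => (p s : ℂ) • v s) =
        fun s => (Real.exp (-γ * s) : ℂ) • ((p s : ℂ) • S s x) := fun p => funext fun s =>
      smul_comm _ _ _
    obtain ⟨R, hRz, hR1⟩ := hR (γ + 2 * Real.pi * ξ * Complex.I) (by simp)
    have e' : ∀ p : ℝ → ℝ, 𝓕 ((Ioi (0 : ℝ)).indicator fun s => (p s : ℂ) • v s) ξ =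
        ∫ s in Ioi (0 : ℝ), (p s : ℂ) •
          Complex.exp (-(γ + 2 * Real.pi * ξ * Complex.I : ℂ) * s) • S s x := fun p => by
      rw [e p, fourier_indicator_Ioi]
      simp only [smul_comm (Complex.exp _)]
    have hint : IntegrableOn (fun s : ℝ => (k s : ℂ) •
        Complex.exp (-(γ + 2 * Real.pi * ξ * Complex.I : ℂ) * s) • S s x) (Ioi 0) := by
      have hb := (integrable_indicator_iff measurableSet_Ioi).1 hg1
      refine Integrable.mono hb ?_ (ae_of_all _ fun s => le_of_eq ?_)
      · refine AEStronglyMeasurable.smul (hk.ofReal (𝕜 := ℂ)).aestronglyMeasurable.restrict ?_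
        exact ((hS.continuousOn_exp_smul _ x).mono Ioi_subset_Ici_self).aestronglyMeasurable
          measurableSet_Ioi
      · simp [v, norm_smul, Complex.norm_exp]
    have h1 : 𝓕 w ξ = R (𝓕 g ξ) := by
      simp only [w, g]
      rw [e' χ, e' k]
      exact integral_primitive_exp_smul hS hM (by simpa using hγ) hRz x hk hint
    rw [h1]
    exact (R.le_opNorm _).trans (mul_le_of_le_one_left (norm_nonneg _) hR1)
  have hmain := integral_norm_sq_le_of_norm_fourier_le hw1 hw2 hg1 hg2 hF
  have hwi : Integrable fun s => ‖w s‖ ^ 2 := hw2.integrable_norm_pow two_ne_zero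
  have hgi : Integrable fun s => ‖g s‖ ^ 2 := hg2.integrable_norm_pow two_ne_zero
  have hgT : ∫ s in Ioc 0 T, ‖g s‖ ^ 2 = ∫ s, ‖g s‖ ^ 2 := by
    refine setIntegral_eq_integral_of_forall_compl_eq_zero fun s hs => ?_
    have : k s = 0 := indicator_of_notMem hs _
    by_cases h0 : s ∈ Ioi (0 : ℝ) <;> simp [g, h0, this]
  have hwT : ∫ s in Ioc 0 T, ‖w s‖ ^ 2 ≤ ∫ s, ‖w s‖ ^ 2 :=
    setIntegral_le_integral hwi (ae_of_all _ fun s => by positivity)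
  -- on `[0,T]` the truncation `k` of `h` has the same primitive as `h`
  have hfin : ∫ s in (0 : ℝ)..T, (h s ^ 2 - (∫ r in (0 : ℝ)..s, h r) ^ 2) *
      (Real.exp (-γ * s) * ‖S s x‖) ^ 2 =
      (∫ s in Ioc 0 T, ‖g s‖ ^ 2) - ∫ s in Ioc 0 T, ‖w s‖ ^ 2 := by
    rw [intervalIntegral.integral_of_le hT, ← integral_sub hgi.integrableOn hwi.integrableOn]
    refine setIntegral_congr_fun measurableSet_Ioc fun s hs => ?_
    have hs0 : s ∈ Ioi (0 : ℝ) := hs.1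
    have hks : k s = h s := indicator_of_mem hs _
    have hχs : χ s = ∫ r in (0 : ℝ)..s, h r := by
      simp only [χ]
      rw [intervalIntegral.integral_of_le hs.1.le, intervalIntegral.integral_of_le hs.1.le]
      exact setIntegral_congr_fun measurableSet_Ioc fun r hr =>
        indicator_of_mem (mem_Ioc.2 ⟨hr.1, hr.2.trans hs.2⟩) _
    simp only [g, w, indicator_of_mem hs0, norm_smul, Complex.norm_real, hvn, hks, hχs,
      Real.norm_eq_abs]
    rw [mul_pow |h s|, mul_pow |∫ r in (0 : ℝ)..s, h r|, sq_abs, sq_abs]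
    ring
  rw [hfin, sub_nonneg, hgT]
  exact hwT.trans hmain

end Energy

/-! ### The piecewise test function -/

theorem intervalIntegral_congr_Ioo {f g : ℝ → ℝ} {a b : ℝ} (hab : a ≤ b)
    (h : EqOn f g (Ioo a b)) : ∫ s in a..b, f s = ∫ s in a..b, g s := by
  rw [intervalIntegral.integral_of_le hab, intervalIntegral.integral_of_le hab,
    integral_Ioc_eq_integral_Ioo, integral_Ioc_eq_integral_Ioo]
  exact setIntegral_congr_fun measurableSet_Ioo h

theorem intervalIntegral_eq_integral_Ioo (f : ℝ → ℝ) {a b : ℝ} (hab : a ≤ b) :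
    ∫ s in a..b, f s = ∫ s in Ioo a b, f s := by
  rw [intervalIntegral.integral_of_le hab, integral_Ioc_eq_integral_Ioo]

/-- Continuous weights keep the integrals of the variational problems finite. -/
theorem IsH1.integrableOn_mul {a : ℝ} {u g : ℝ → ℝ} (h : IsH1 a u g) {q : ℝ → ℝ}
    (hq : ContinuousOn q (Icc 0 a)) :
    IntegrableOn (fun s => q s * (g s ^ 2 - u s ^ 2)) (Ioo 0 a) := by
  have h1 : IntegrableOn (fun s => g s ^ 2 - u s ^ 2) (Icc 0 a) := by
    rw [integrableOn_Icc_iff_integrableOn_Ioo]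
    exact h.memLp_deriv.integrable_sq.sub h.memLp.integrable_sq
  exact (h1.continuousOn_mul hq isCompact_Icc).mono_set Ioo_subset_Icc_self

/-- The derivative of the function equal to `u` on `[0,a]`, to `e^{s-a}` on `[a,t-b]` and to
`e^{t-a-b} θ(t-s)` on `[t-b,t]`, where `g = u'` and `k = θ'`. -/
noncomputable def gluedDeriv (a b t : ℝ) (g k : ℝ → ℝ) (s : ℝ) : ℝ :=
  (Ioo 0 a).indicator g s + (Ioo a (t - b)).indicator (fun r => Real.exp (r - a)) s -
    Real.exp (t - a - b) * (Ioo 0 b).indicator k (t - s)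

section Glued

variable {a b t : ℝ} {g k : ℝ → ℝ}

theorem gluedDeriv_left (hab : a + b ≤ t) {s : ℝ} (hs : s ∈ Ioo 0 a) :
    gluedDeriv a b t g k s = g s := by
  have h2 : s ∉ Ioo a (t - b) := fun h => lt_asymm h.1 hs.2
  have h3 : t - s ∉ Ioo 0 b := fun h => by linarith [h.2, hs.2]
  simp [gluedDeriv, indicator_of_mem hs, indicator_of_notMem h2, indicator_of_notMem h3]

theorem gluedDeriv_middle {s : ℝ} (hs : s ∈ Ioo a (t - b)) :
    gluedDeriv a b t g k s = Real.exp (s - a) := by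
  have h2 : s ∉ Ioo 0 a := fun h => lt_asymm h.2 hs.1
  have h3 : t - s ∉ Ioo 0 b := fun h => by linarith [h.2, hs.2]
  simp [gluedDeriv, indicator_of_mem hs, indicator_of_notMem h2, indicator_of_notMem h3]

theorem gluedDeriv_right (hab : a + b ≤ t) {s : ℝ} (hs : s ∈ Ioo (t - b) t) :
    gluedDeriv a b t g k s = -(Real.exp (t - a - b) * k (t - s)) := by
  have h2 : s ∉ Ioo 0 a := fun h => by linarith [h.2, hs.1]
  have h3 : s ∉ Ioo a (t - b) := fun h => lt_asymm h.2 hs.1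
  have h4 : t - s ∈ Ioo 0 b := ⟨by linarith [hs.2], by linarith [hs.1]⟩
  simp [gluedDeriv, indicator_of_mem h4, indicator_of_notMem h2, indicator_of_notMem h3]

theorem memLp_gluedDeriv {p : ℝ≥0∞} (hg : MemLp g p (volume.restrict (Ioo 0 a)))
    (hk : MemLp k p (volume.restrict (Ioo 0 b))) : MemLp (gluedDeriv a b t g k) p := by
  have h1 := (memLp_indicator_iff_restrict measurableSet_Ioo).2 hg
  have h2 : MemLp ((Ioo a (t - b)).indicator (fun r => Real.exp (r - a))) p := by
    rw [memLp_indicator_iff_restrict measurableSet_Ioo]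
    refine MemLp.of_bound (by fun_prop) (Real.exp (t - b - a)) ?_
    filter_upwards [ae_restrict_mem measurableSet_Ioo] with s hs
    rw [Real.norm_eq_abs, Real.abs_exp, Real.exp_le_exp]
    linarith [hs.2]
  have h3 := ((memLp_indicator_iff_restrict measurableSet_Ioo).2 hk).comp_measurePreserving
    (Measure.measurePreserving_sub_left volume t)
  exact (h1.add h2).sub (h3.const_mul (Real.exp (t - a - b)))

variable {u θ : ℝ → ℝ}

theorem integral_gluedDeriv_left (ha : 0 < a) (hab : a + b ≤ t) (hu : IsH1 a u g) (hu0 : u 0 = 0)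
    {s : ℝ} (hs : s ∈ Icc 0 a) : ∫ r in (0 : ℝ)..s, gluedDeriv a b t g k r = u s := by
  rw [hu.eq_add_integral ha hs, hu0, zero_add]
  exact intervalIntegral_congr_Ioo hs.1 fun r hr =>
    gluedDeriv_left hab ⟨hr.1, hr.2.trans_le hs.2⟩

theorem integral_gluedDeriv_middle (ha : 0 < a) (hab : a + b ≤ t) (hu : IsH1 a u g)
    (hu0 : u 0 = 0) (hua : u a = 1) (hθ : IsH1 b θ k) {s : ℝ} (hs : s ∈ Icc a (t - b)) :
    ∫ r in (0 : ℝ)..s, gluedDeriv a b t g k r = Real.exp (s - a) := by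
  have hi : Integrable (gluedDeriv a b t g k) := memLp_one_iff_integrable.1
    (memLp_gluedDeriv (memLp_one_iff_integrable.2 hu.integrableOn_deriv)
      (memLp_one_iff_integrable.2 hθ.integrableOn_deriv))
  rw [← intervalIntegral.integral_add_adjacent_intervals (b := a) hi.intervalIntegrable
    hi.intervalIntegrable, integral_gluedDeriv_left ha hab hu hu0 ⟨ha.le, le_rfl⟩, hua,
    intervalIntegral_congr_Ioo hs.1 (g := fun r => Real.exp (r - a)) fun r hr =>
      gluedDeriv_middle ⟨hr.1, hr.2.trans_le hs.2⟩,
    intervalIntegral.integral_comp_sub_right (fun r => Real.exp r), integral_exp]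
  simp

theorem integral_gluedDeriv_right (ha : 0 < a) (hb : 0 < b) (hab : a + b ≤ t) (hu : IsH1 a u g)
    (hu0 : u 0 = 0) (hua : u a = 1) (hθ : IsH1 b θ k) (hθb : θ b = 1) {s : ℝ}
    (hs : s ∈ Icc (t - b) t) :
    ∫ r in (0 : ℝ)..s, gluedDeriv a b t g k r = Real.exp (t - a - b) * θ (t - s) := by
  have hi : Integrable (gluedDeriv a b t g k) := memLp_one_iff_integrable.1
    (memLp_gluedDeriv (memLp_one_iff_integrable.2 hu.integrableOn_deriv)
      (memLp_one_iff_integrable.2 hθ.integrableOn_deriv))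
  have hk : IntervalIntegrable k volume 0 b := by
    rw [intervalIntegrable_iff_integrableOn_Ioo_of_le hb.le]
    exact hθ.integrableOn_deriv
  have hts : t - s ∈ Icc 0 b := ⟨by linarith [hs.2], by linarith [hs.1]⟩
  rw [← intervalIntegral.integral_add_adjacent_intervals (b := t - b) hi.intervalIntegrable
    hi.intervalIntegrable,
    integral_gluedDeriv_middle ha hab hu hu0 hua hθ ⟨by linarith, le_rfl⟩,
    intervalIntegral_congr_Ioo hs.1 (g := fun r => -(Real.exp (t - a - b) * k (t - r)))
      fun r hr => gluedDeriv_right hab ⟨hr.1, hr.2.trans_le hs.2⟩,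
    intervalIntegral.integral_neg, intervalIntegral.integral_const_mul,
    intervalIntegral.integral_comp_sub_left (fun r => k r), sub_sub_cancel,
    sub_right_comm t b a]
  have h1 := hθ.eq_add_integral hb hts
  have h2 := hθ.eq_add_integral hb ⟨hb.le, le_rfl⟩
  have h3 := intervalIntegral.integral_add_adjacent_intervals
    (hk.mono_set (uIcc_subset_uIcc left_mem_uIcc (by rwa [uIcc_of_le hb.le])) :
      IntervalIntegrable k volume 0 (t - s))
    (hk.mono_set (uIcc_subset_uIcc (by rwa [uIcc_of_le hb.le]) right_mem_uIcc))
  rw [hθb] at h2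
  rw [show ∫ r in (t - s)..b, k r = 1 - θ (t - s) by linarith]
  ring

end Glued

/-! ### Comparison of the two variational functionals -/

section Comparison

variable {H : Type*} [NormedAddCommGroup H] [InnerProductSpace ℂ H] {S : ℝ → H →L[ℂ] H}

theorem IsC0Semigroup.apply_add (hS : IsC0Semigroup S) {s t : ℝ} (hs : 0 ≤ s) (ht : 0 ≤ t)
    (x : H) : S (s + t) x = S s (S t x) := by
  rw [hS.map_add s t hs ht]; rfl

variable [CompleteSpace H] {m : ℝ → ℝ} {a b t : ℝ} {u u' θ θ' : ℝ → ℝ}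

/-- The energy inequality for the glued test function: the middle piece contributes nothing, since
there `χ' = χ`, and on the last piece `S(t) x = S(t - s) S(s) x` bounds `S(s) x` from below. -/
theorem norm_apply_sq_mul_le (hS : IsC0Semigroup S) {M l γ : ℝ}
    (hM : ∀ t : ℝ, 0 ≤ t → ‖S t‖ ≤ M * Real.exp (l * t)) (hγ : l < γ) (hγ0 : 0 ≤ γ)
    (hR : ∀ z : ℂ, z.re = γ → ∃ R : H →L[ℂ] H, IsResolventAt (generator S) z R ∧ ‖R‖ ≤ 1)
    (hmc : ContinuousOn m (Ici 0)) (hm0 : ∀ t : ℝ, 0 ≤ t → 0 < m t)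
    (hm : ∀ t : ℝ, 0 ≤ t → ‖S t‖ ≤ m t) (ha : 0 < a) (hb : 0 < b) (hab : a + b ≤ t)
    (hu : IsH1 a u u') (hu0 : u 0 = 0) (hua : u a = 1) (hθ : IsH1 b θ θ') (hθb : θ b = 1)
    (hθ' : ∀ᵐ s ∂(volume.restrict (Ioo 0 b)), |θ' s| ≤ θ s) (x : H) :
    (Real.exp (t - a - b) * (Real.exp (-γ * t) * ‖S t x‖)) ^ 2 *
        (∫ s in Ioo 0 b, 1 / m s ^ 2 * (θ s ^ 2 - θ' s ^ 2)) ≤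
      (∫ s in Ioo 0 a, m s ^ 2 * max (u' s ^ 2 - u s ^ 2) 0) * ‖x‖ ^ 2 := by
  have ht : 0 ≤ t := by linarith
  set h := gluedDeriv a b t u' θ' with hh
  set E := Real.exp (t - a - b) with hE
  have hh2 : MemLp h 2 := memLp_gluedDeriv hu.memLp_deriv hθ.memLp_deriv
  have hh1 : Integrable h := memLp_one_iff_integrable.1
    (memLp_gluedDeriv (memLp_one_iff_integrable.2 hu.integrableOn_deriv)
      (memLp_one_iff_integrable.2 hθ.integrableOn_deriv))
  let χ : ℝ → ℝ := fun s => ∫ r in (0 : ℝ)..s, h r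
  let N : ℝ → ℝ := fun s => (Real.exp (-γ * s) * ‖S s x‖) ^ 2
  let F : ℝ → ℝ := fun s => (h s ^ 2 - χ s ^ 2) * N s
  have hχc : Continuous χ :=
    intervalIntegral.continuous_primitive (fun _ _ => hh1.intervalIntegrable) 0
  have hNc : ContinuousOn N (Icc 0 t) :=
    ((Continuous.continuousOn (by fun_prop)).mul
      ((hS.continuousOn x).mono Icc_subset_Ici_self).norm).pow 2
  have hFi : IntegrableOn F (Icc 0 t) :=
    ((hh2.integrable_sq.integrableOn).sub (hχc.pow 2).integrableOn_Icc).mul_continuousOn hNc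
      isCompact_Icc
  have hFii : ∀ c d : ℝ, 0 ≤ c → c ≤ d → d ≤ t → IntervalIntegrable F volume c d :=
    fun c d hc hcd hd => (intervalIntegrable_iff_integrableOn_Icc_of_le hcd).2
      (hFi.mono_set (Icc_subset_Icc hc hd))
  have hEn : 0 ≤ ∫ s in (0 : ℝ)..t, F s :=
    integral_energy_nonneg hS hM hγ hR x ht (hh2.restrict _)
  rw [← intervalIntegral.integral_add_adjacent_intervals
      (hFii 0 a le_rfl ha.le (by linarith)) (hFii a t ha.le (by linarith) le_rfl),
    ← intervalIntegral.integral_add_adjacent_intervals (b := t - b)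
      (hFii a (t - b) ha.le (by linarith) (by linarith))
      (hFii (t - b) t (by linarith) (by linarith) le_rfl)] at hEn
  have hN0 : ∀ s, 0 ≤ N s := fun s => sq_nonneg _
  have hB : ∫ s in a..(t - b), F s = 0 := by
    rw [intervalIntegral_congr_Ioo (g := fun _ => 0) (by linarith), intervalIntegral.integral_zero]
    intro s hs
    have h1 : h s = Real.exp (s - a) := gluedDeriv_middle hs
    have h2 : χ s = Real.exp (s - a) :=
      integral_gluedDeriv_middle ha hab hu hu0 hua hθ (Ioo_subset_Icc_self hs)
    simp only [F, h1, h2, sub_self, zero_mul]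
  have hA : ∫ s in (0 : ℝ)..a, F s ≤
      (∫ s in Ioo 0 a, m s ^ 2 * max (u' s ^ 2 - u s ^ 2) 0) * ‖x‖ ^ 2 := by
    rw [intervalIntegral_eq_integral_Ioo _ ha.le, ← integral_mul_const]
    have hmi : IntegrableOn (fun s => m s ^ 2 * max (u' s ^ 2 - u s ^ 2) 0) (Ioo 0 a) := by
      have := (hu.integrableOn_mul (q := fun s => m s ^ 2)
        ((hmc.mono Icc_subset_Ici_self).pow 2)).pos_part
      refine this.congr (ae_of_all _ fun s => ?_)
      simp only
      rw [mul_max_of_nonneg _ _ (sq_nonneg (m s)), mul_zero]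
    refine setIntegral_mono_on (hFi.mono_set fun s hs => ⟨hs.1.le, by linarith [hs.2]⟩)
      (hmi.mul_const _) measurableSet_Ioo fun s hs => ?_
    have h1 : h s = u' s := gluedDeriv_left hab hs
    have h2 : χ s = u s :=
      integral_gluedDeriv_left ha hab hu hu0 (Ioo_subset_Icc_self hs)
    have h3 : N s ≤ (m s * ‖x‖) ^ 2 := by
      refine pow_le_pow_left₀ (by positivity) ?_ 2
      have h4 : Real.exp (-γ * s) ≤ 1 := Real.exp_le_one_iff.2 (by
        have := mul_nonneg hγ0 hs.1.le
        linarith)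
      refine (mul_le_of_le_one_left (norm_nonneg _) h4).trans (((S s).le_opNorm x).trans ?_)
      gcongr
      exact hm s hs.1.le
    simp only [F, h1, h2]
    calc (u' s ^ 2 - u s ^ 2) * N s ≤ max (u' s ^ 2 - u s ^ 2) 0 * N s :=
          mul_le_mul_of_nonneg_right (le_max_left _ _) (hN0 s)
      _ ≤ max (u' s ^ 2 - u s ^ 2) 0 * (m s * ‖x‖) ^ 2 :=
          mul_le_mul_of_nonneg_left h3 (le_max_right _ _)
      _ = _ := by ring
  have hC : ∫ s in (t - b)..t, F s ≤ -((E * (Real.exp (-γ * t) * ‖S t x‖)) ^ 2 *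
        (∫ s in Ioo 0 b, 1 / m s ^ 2 * (θ s ^ 2 - θ' s ^ 2))) := by
    have e := intervalIntegral.integral_comp_sub_left (a := 0) (b := b) F t
    rw [sub_zero] at e
    have hqi : IntegrableOn (fun s => 1 / m s ^ 2 * (θ s ^ 2 - θ' s ^ 2)) (Ioo 0 b) := by
      have := (hθ.integrableOn_mul (q := fun s => 1 / m s ^ 2)
        (continuousOn_const.div ((hmc.mono Icc_subset_Ici_self).pow 2)
          fun s hs => pow_ne_zero 2 (hm0 s hs.1).ne')).neg
      exact this.congr (ae_of_all _ fun s => by simp only [Pi.neg_apply]; ring)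
    have hFr : IntegrableOn (fun s => F (t - s)) (Ioo 0 b) := by
      rw [← intervalIntegrable_iff_integrableOn_Ioo_of_le hb.le]
      have := (hFii (t - b) t (by linarith) (by linarith) le_rfl).comp_sub_left t
      rw [sub_sub_cancel, sub_self] at this
      exact this.symm
    rw [← e, intervalIntegral_eq_integral_Ioo _ hb.le, ← integral_const_mul, ← integral_neg]
    refine integral_mono_ae hFr (hqi.const_mul _).neg ?_
    filter_upwards [hθ', ae_restrict_mem measurableSet_Ioo] with s hs1 hs
    have hts : t - s ∈ Ioo (t - b) t := ⟨by linarith [hs.2], by linarith [hs.1]⟩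
    have h1 : h (t - s) = -(E * θ' s) := by
      have := gluedDeriv_right (g := u') (k := θ') hab hts
      rwa [sub_sub_cancel] at this
    have h2 : χ (t - s) = E * θ s := by
      have := integral_gluedDeriv_right ha hb hab hu hu0 hua hθ hθb (Ioo_subset_Icc_self hts)
      rwa [sub_sub_cancel] at this
    have h3 : (Real.exp (-γ * t) * ‖S t x‖) ^ 2 ≤ m s ^ 2 * N (t - s) := by
      rw [← mul_pow]
      refine pow_le_pow_left₀ (by positivity) ?_ 2
      have h4 : ‖S t x‖ ≤ m s * ‖S (t - s) x‖ := by
        have h5 := hS.apply_add hs.1.le (by linarith [hs.2] : 0 ≤ t - s) x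
        rw [add_sub_cancel] at h5
        rw [h5]
        refine ((S s).le_opNorm _).trans ?_
        gcongr
        exact hm s hs.1.le
      have h6 : Real.exp (-γ * t) ≤ Real.exp (-γ * (t - s)) := Real.exp_le_exp.2 (by
        have := mul_nonneg hγ0 hs.1.le
        linarith)
      calc Real.exp (-γ * t) * ‖S t x‖ ≤ Real.exp (-γ * (t - s)) * (m s * ‖S (t - s) x‖) := by
            gcongr
        _ = _ := by ring
    have h7 : (Real.exp (-γ * t) * ‖S t x‖) ^ 2 * (1 / m s ^ 2) ≤ N (t - s) := by
      have := hm0 s hs.1.le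
      rw [mul_one_div, div_le_iff₀ (by positivity)]
      linarith
    have h8 : 0 ≤ θ s ^ 2 - θ' s ^ 2 := by
      have := sq_le_sq' (neg_le_of_abs_le hs1) (le_of_abs_le hs1)
      linarith
    simp only [F, h1, h2]
    have h9 := mul_le_mul_of_nonneg_left h7 (mul_nonneg (sq_nonneg E) h8)
    nlinarith [h9]
  linarith

end Comparison

/-! ### The extremal values -/

section Extremal

variable {m : ℝ → ℝ} {a b : ℝ}

theorem infValues_nonneg {c : ℝ} (hc : c ∈ infValues m a) : 0 ≤ c := by
  obtain ⟨u, u', -, -, -, rfl⟩ := hc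
  exact integral_nonneg fun s => mul_nonneg (sq_nonneg _) (le_max_right _ _)

theorem isH1_div (ha : 0 < a) : IsH1 a (fun s => s / a) (fun _ => 1 / a) :=
  isH1_of_hasDerivAt ha (fun s => (hasDerivAt_id s).div_const a) continuous_const

theorem isH1_one (hb : 0 < b) : IsH1 b (fun _ => 1) (fun _ => 0) :=
  isH1_of_hasDerivAt hb (fun s => hasDerivAt_const s 1) continuous_const

theorem infValues_nonempty (ha : 0 < a) : (infValues m a).Nonempty :=
  ⟨_, _, _, isH1_div ha, by simp, div_self ha.ne', rfl⟩

theorem integrableOn_one_div_sq (hmc : ContinuousOn m (Ici 0)) (hm0 : ∀ t : ℝ, 0 ≤ t → 0 < m t) :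
    IntegrableOn (fun s => 1 / m s ^ 2) (Ioo 0 b) :=
  ((continuousOn_const.div ((hmc.mono Icc_subset_Ici_self).pow 2)
    fun s hs => pow_ne_zero 2 (hm0 s hs.1).ne').integrableOn_Icc (a := 0) (b := b)).mono_set
      Ioo_subset_Icc_self

theorem exists_pos_mem_supValues (hmc : ContinuousOn m (Ici 0)) (hm0 : ∀ t : ℝ, 0 ≤ t → 0 < m t)
    (hb : 0 < b) : ∃ c ∈ supValues m b, 0 < c := by
  refine ⟨_, ⟨_, _, isH1_one hb, rfl, by simp, rfl⟩, ?_⟩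
  have h : ∫ s in Ioo 0 b, 1 / m s ^ 2 * ((1 : ℝ) ^ 2 - 0 ^ 2) = ∫ s in Ioo 0 b, 1 / m s ^ 2 := by
    simp
  rw [h, ← intervalIntegral_eq_integral_Ioo _ hb.le]
  refine intervalIntegral.intervalIntegral_pos_of_pos_on ?_ (fun s hs => ?_) hb
  · rw [intervalIntegrable_iff_integrableOn_Ioo_of_le hb.le]
    exact integrableOn_one_div_sq hmc hm0
  · have := hm0 s hs.1.le
    positivity

/-- Grönwall's inequality for the constraint `|θ'| ≤ θ`, `θ(b) = 1`. -/
theorem le_exp_of_abs_deriv_le (hb : 0 < b) {θ θ' : ℝ → ℝ} (hθ : IsH1 b θ θ') (hθb : θ b = 1)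
    (hθ' : ∀ᵐ s ∂(volume.restrict (Ioo 0 b)), |θ' s| ≤ θ s) {s : ℝ} (hs : s ∈ Icc 0 b) :
    θ s ≤ Real.exp b := by
  have hci : ∀ c d : ℝ, c ∈ Icc 0 b → d ∈ Icc 0 b → IntervalIntegrable θ volume c d :=
    fun c d hc hd => (hθ.continuousOn.mono
      ((convex_Icc 0 b).ordConnected.uIcc_subset hc hd)).intervalIntegrable
  have hki : ∀ c ∈ Icc 0 b, IntervalIntegrable θ' volume c b := fun c hc => by
    rw [intervalIntegrable_iff_integrableOn_Ioo_of_le hc.2]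
    exact hθ.integrableOn_deriv.mono_set (Ioo_subset_Ioo_left hc.1)
  have hb0 : (0 : ℝ) ∈ Icc 0 b := ⟨le_rfl, hb.le⟩
  have hbb : b ∈ Icc 0 b := ⟨hb.le, le_rfl⟩
  -- `p` majorizes `θ` and, unlike `θ`, is differentiable; `p' = -θ ≥ -p` makes `e^r p(r)` monotone
  let p : ℝ → ℝ := fun r => 1 + ∫ y in r..b, θ y
  have hθp : ∀ r ∈ Icc 0 b, θ r ≤ p r := fun r hr => by
    have h1 := hθ.eq_add_integral hb hr
    have h2 := hθ.eq_add_integral hb hbb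
    have h3 := intervalIntegral.integral_interval_sub_left (hki 0 hb0)
      ((hki 0 hb0).trans (hki r hr).symm)
    have h4 : ∫ y in r..b, -θ' y ≤ ∫ y in r..b, θ y := by
      refine intervalIntegral.integral_mono_ae_restrict hr.2 (hki r hr).neg (hci r b hr hbb) ?_
      rw [Measure.restrict_congr_set Ioo_ae_eq_Icc.symm]
      filter_upwards [ae_restrict_of_ae_restrict_of_subset (Ioo_subset_Ioo_left hr.1) hθ'] with y hy
      exact (neg_le_abs _).trans hy
    rw [intervalIntegral.integral_neg] at h4
    rw [hθb] at h2
    simp only [p]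
    linarith
  have hpd : ∀ r ∈ Ioo 0 b, HasDerivAt p (-θ r) r := fun r hr =>
    (intervalIntegral.integral_hasDerivAt_left (hci r b (Ioo_subset_Icc_self hr) hbb)
      ((hθ.continuousOn.mono Ioo_subset_Icc_self).stronglyMeasurableAtFilter isOpen_Ioo r hr)
      (hθ.continuousOn.continuousAt (Icc_mem_nhds hr.1 hr.2))).const_add 1
  have hpc : ContinuousOn p (Icc 0 b) := by
    refine continuousOn_const.add ?_
    have := intervalIntegral.continuousOn_primitive_interval_left (μ := volume) (a := 0) (b := b)
      (f := θ) (by rw [uIcc_of_le hb.le]; exact hθ.continuousOn.integrableOn_Icc)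
    rwa [uIcc_of_le hb.le] at this
  have hmono : MonotoneOn (fun r => Real.exp r * p r) (Icc 0 b) := by
    refine monotoneOn_of_hasDerivWithinAt_nonneg (convex_Icc 0 b)
      (Real.continuous_exp.continuousOn.mul hpc)
      (f' := fun r => Real.exp r * p r + Real.exp r * (-θ r)) (fun r hr => ?_) fun r hr => ?_
    · rw [interior_Icc] at hr ⊢
      exact ((Real.hasDerivAt_exp r).mul (hpd r hr)).hasDerivWithinAt
    · rw [interior_Icc] at hr
      have := mul_le_mul_of_nonneg_left (hθp r (Ioo_subset_Icc_self hr)) (Real.exp_pos r).le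
      linarith
  have h1 := hmono hs hbb hs.2
  simp only [p, intervalIntegral.integral_same, add_zero, mul_one] at h1
  have h2 : 0 < p s := by
    have h3 : (0 : ℝ) ≤ ∫ y in s..b, θ y := by
      refine intervalIntegral.integral_nonneg_of_ae_restrict hs.2 ?_
      rw [Measure.restrict_congr_set Ioo_ae_eq_Icc.symm]
      filter_upwards [ae_restrict_of_ae_restrict_of_subset (Ioo_subset_Ioo_left hs.1) hθ'] with y hy
      exact (abs_nonneg _).trans hy
    simp only [p]; linarith
  calc θ s ≤ p s := hθp s hs
    _ ≤ Real.exp s * p s := le_mul_of_one_le_left h2.le (Real.one_le_exp hs.1)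
    _ ≤ Real.exp b := h1

theorem bddAbove_supValues (hmc : ContinuousOn m (Ici 0)) (hm0 : ∀ t : ℝ, 0 ≤ t → 0 < m t)
    (hb : 0 < b) : BddAbove (supValues m b) := by
  refine ⟨∫ s in Ioo 0 b, 1 / m s ^ 2 * Real.exp b ^ 2, ?_⟩
  rintro c ⟨θ, θ', hθ, hθb, hθ', rfl⟩
  refine integral_mono_of_nonneg ?_ ((integrableOn_one_div_sq hmc hm0).mul_const _) ?_
  · filter_upwards [hθ'] with s hs
    have := sq_le_sq' (neg_le_of_abs_le hs) (le_of_abs_le hs)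
    exact mul_nonneg (by positivity) (by linarith)
  · filter_upwards [hθ', ae_restrict_mem measurableSet_Ioo] with s hs1 hs
    have h1 := le_exp_of_abs_deriv_le hb hθ hθb hθ' (Ioo_subset_Icc_self hs)
    have h2 := pow_le_pow_left₀ ((abs_nonneg _).trans hs1) h1 2
    refine mul_le_mul_of_nonneg_left ?_ (by positivity)
    linarith [sq_nonneg (θ' s)]

end Extremal

/-! ### Exponential growth -/

section Growth

variable {H : Type*} [NormedAddCommGroup H] [InnerProductSpace ℂ H] {S : ℝ → H →L[ℂ] H}

/-- A semigroup bounded on `[0,1]` grows at most exponentially. -/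
theorem IsC0Semigroup.exists_exp_bound (hS : IsC0Semigroup S) {B : ℝ}
    (hB : ∀ t ∈ Icc (0 : ℝ) 1, ‖S t‖ ≤ B) :
    ∃ M l : ℝ, ∀ t : ℝ, 0 ≤ t → ‖S t‖ ≤ M * Real.exp (l * t) := by
  set M := max B 1 with hMdef
  have hM1 : 1 ≤ M := le_max_right _ _
  have hM0 : 0 < M := by linarith
  have hn : ∀ n : ℕ, ∀ s ∈ Icc (0 : ℝ) 1, ‖S (s + n)‖ ≤ M * M ^ n := by
    intro n
    induction n with
    | zero =>
      intro s hs
      simpa only [Nat.cast_zero, add_zero, pow_zero, mul_one] using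
        (hB s hs).trans (le_max_left B 1)
    | succ n ih =>
      intro s hs
      have e : s + ((n + 1 : ℕ) : ℝ) = 1 + (s + n) := by push_cast; ring
      rw [e, hS.map_add 1 (s + n) zero_le_one (by have := hs.1; positivity)]
      refine (ContinuousLinearMap.opNorm_comp_le _ _).trans ?_
      calc ‖S 1‖ * ‖S (s + n)‖ ≤ M * (M * M ^ n) := by
            gcongr
            · exact (hB 1 ⟨zero_le_one, le_rfl⟩).trans (le_max_left B 1)
            · exact ih s hs
        _ = _ := by ring
  refine ⟨M, Real.log M, fun t ht => ?_⟩
  have h1 := hn ⌊t⌋₊ (t - ⌊t⌋₊) ⟨sub_nonneg.2 (Nat.floor_le ht),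
    by linarith [Nat.lt_floor_add_one t]⟩
  rw [sub_add_cancel] at h1
  refine h1.trans ?_
  gcongr
  calc M ^ ⌊t⌋₊ = Real.exp (Real.log M * ⌊t⌋₊) := by
        rw [mul_comm, Real.exp_nat_mul, Real.exp_log hM0]
    _ ≤ Real.exp (Real.log M * t) := by
        have := Real.log_nonneg hM1
        gcongr
        exact Nat.floor_le ht

variable [CompleteSpace H] {m : ℝ → ℝ}

/-- `norm_apply_sq_mul_le` in terms of the operator norm. -/
theorem exp_mul_norm_sq_mul_le (hS : IsC0Semigroup S) {M l γ : ℝ}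
    (hM : ∀ t : ℝ, 0 ≤ t → ‖S t‖ ≤ M * Real.exp (l * t)) (hγ : l < γ) (hγ0 : 0 ≤ γ)
    (hR : ∀ z : ℂ, z.re = γ → ∃ R : H →L[ℂ] H, IsResolventAt (generator S) z R ∧ ‖R‖ ≤ 1)
    (hmc : ContinuousOn m (Ici 0)) (hm0 : ∀ t : ℝ, 0 ≤ t → 0 < m t)
    (hm : ∀ t : ℝ, 0 ≤ t → ‖S t‖ ≤ m t) {a b t : ℝ} (ha : 0 < a) (hb : 0 < b) (hab : a + b ≤ t)
    {c d : ℝ} (hc : c ∈ infValues m a) (hd : d ∈ supValues m b) :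
    (Real.exp (t - a - b) * (Real.exp (-γ * t) * ‖S t‖)) ^ 2 * d ≤ c := by
  have hc0 := infValues_nonneg hc
  obtain ⟨u, u', hu, hu0, hua, hcu⟩ := hc
  obtain ⟨θ, θ', hθ, hθb, hθ', hdθ⟩ := hd
  rcases le_or_gt d 0 with h | h
  · exact (mul_nonpos_of_nonneg_of_nonpos (sq_nonneg _) h).trans hc0
  have key : ∀ x : H, (Real.exp (t - a - b) * (Real.exp (-γ * t) * ‖S t x‖)) ^ 2 * d ≤
      c * ‖x‖ ^ 2 := fun x => by
    rw [hcu, hdθ]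
    exact norm_apply_sq_mul_le hS hM hγ hγ0 hR hmc hm0 hm ha hb hab hu hu0 hua hθ hθb hθ' x
  set e := Real.exp (t - a - b) * Real.exp (-γ * t) with he
  have he0 : 0 < e := by positivity
  have h1 : ‖S t‖ ≤ Real.sqrt (c / d) / e := by
    refine ContinuousLinearMap.opNorm_le_bound _ (by positivity) fun x => ?_
    rw [div_mul_eq_mul_div, le_div_iff₀ he0]
    refine (sq_le_sq₀ (by positivity) (by positivity)).1 ?_
    rw [mul_pow (Real.sqrt _), Real.sq_sqrt (by positivity), div_mul_eq_mul_div, le_div_iff₀ h]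
    calc (‖S t x‖ * e) ^ 2 * d = _ := by rw [he]; ring
      _ ≤ _ := key x
  rw [le_div_iff₀ he0] at h1
  have h2 := pow_le_pow_left₀ (by positivity) h1 2
  rw [Real.sq_sqrt (by positivity), le_div_iff₀ h] at h2
  calc _ = (‖S t‖ * e) ^ 2 * d := by rw [he]; ring
    _ ≤ c := h2

/-- The resolvent estimate on the line `Re z = l + 1/2` improves the growth rate `l` by `1/2`. -/
theorem exists_exp_bound_sub_half (hS : IsC0Semigroup S)
    (hR : ∀ z : ℂ, 0 < z.re → ∃ R : H →L[ℂ] H, IsResolventAt (generator S) z R ∧ ‖R‖ ≤ 1)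
    (hmc : ContinuousOn m (Ici 0)) (hm0 : ∀ t : ℝ, 0 ≤ t → 0 < m t)
    (hm : ∀ t : ℝ, 0 ≤ t → ‖S t‖ ≤ m t) {M l : ℝ} (hl : 0 ≤ l)
    (hM : ∀ t : ℝ, 0 ≤ t → ‖S t‖ ≤ M * Real.exp (l * t)) :
    ∃ M' : ℝ, ∀ t : ℝ, 0 ≤ t → ‖S t‖ ≤ M' * Real.exp ((l - 1 / 2) * t) := by
  obtain ⟨c, hc⟩ := infValues_nonempty (m := m) one_pos
  obtain ⟨d, hd, hd0⟩ := exists_pos_mem_supValues hmc hm0 one_pos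
  have hc0 := infValues_nonneg hc
  obtain ⟨B, hB⟩ := isCompact_Icc.exists_bound_of_continuousOn (s := Icc (0 : ℝ) 2)
    (f := fun t => m t * Real.exp (-((l - 1 / 2) * t)))
    ((hmc.mono Icc_subset_Ici_self).mul (Continuous.continuousOn (by fun_prop)))
  refine ⟨max B (Real.sqrt (c / d) * Real.exp 2), fun t ht => ?_⟩
  rcases le_total t 2 with h2 | h2
  · have h3 := (le_abs_self _).trans (hB t ⟨ht, h2⟩)
    rw [Real.exp_neg, ← div_eq_mul_inv, div_le_iff₀ (Real.exp_pos _)] at h3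
    exact (hm t ht).trans (h3.trans (by gcongr; exact le_max_left _ _))
  · have h3 := exp_mul_norm_sq_mul_le hS hM (γ := l + 1 / 2) (by linarith) (by linarith)
      (fun z hz => hR z (by rw [hz]; linarith)) hmc hm0 hm one_pos one_pos (t := t)
      (by linarith) hc hd
    rw [← le_div_iff₀ hd0] at h3
    have h4 := Real.le_sqrt_of_sq_le h3
    have h5 : ‖S t‖ = Real.exp (t - 1 - 1) * (Real.exp (-(l + 1 / 2) * t) * ‖S t‖) *
        Real.exp 2 * Real.exp ((l - 1 / 2) * t) := by
      have : Real.exp (t - 1 - 1) * Real.exp (-(l + 1 / 2) * t) * Real.exp 2 *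
          Real.exp ((l - 1 / 2) * t) = 1 := by
        rw [← Real.exp_add, ← Real.exp_add, ← Real.exp_add, Real.exp_eq_one_iff]
        ring
      calc ‖S t‖ = (Real.exp (t - 1 - 1) * Real.exp (-(l + 1 / 2) * t) * Real.exp 2 *
          Real.exp ((l - 1 / 2) * t)) * ‖S t‖ := by rw [this, one_mul]
        _ = _ := by ring
    rw [h5]
    gcongr
    exact (mul_le_mul_of_nonneg_right h4 (Real.exp_pos 2).le).trans (le_max_right _ _)

/-- The semigroup is bounded: the growth rate is lowered in steps of `1/2` until it is `0`. -/
theorem exists_bound (hS : IsC0Semigroup S)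
    (hR : ∀ z : ℂ, 0 < z.re → ∃ R : H →L[ℂ] H, IsResolventAt (generator S) z R ∧ ‖R‖ ≤ 1)
    (hmc : ContinuousOn m (Ici 0)) (hm0 : ∀ t : ℝ, 0 ≤ t → 0 < m t)
    (hm : ∀ t : ℝ, 0 ≤ t → ‖S t‖ ≤ m t) :
    ∃ M : ℝ, ∀ t : ℝ, 0 ≤ t → ‖S t‖ ≤ M * Real.exp (0 * t) := by
  obtain ⟨B, hB⟩ := isCompact_Icc.exists_bound_of_continuousOn (s := Icc (0 : ℝ) 1)
    (hmc.mono Icc_subset_Ici_self)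
  obtain ⟨M, l, hM⟩ := hS.exists_exp_bound (B := B) fun t ht =>
    (hm t ht.1).trans ((le_abs_self _).trans (hB t ht))
  have hstep : ∀ n : ℕ, (∃ M : ℝ, ∀ t : ℝ, 0 ≤ t → ‖S t‖ ≤ M * Real.exp ((n / 2 : ℝ) * t)) →
      ∃ M : ℝ, ∀ t : ℝ, 0 ≤ t → ‖S t‖ ≤ M * Real.exp (0 * t) := by
    intro n
    induction n with
    | zero => simp
    | succ n ih =>
      rintro ⟨M, hM⟩
      obtain ⟨M', hM'⟩ := exists_exp_bound_sub_half hS hR hmc hm0 hm (by positivity) hM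
      refine ih ⟨M', fun t ht => (hM' t ht).trans_eq ?_⟩
      congr 3
      push_cast
      ring
  have hM0 : 0 ≤ M := by simpa using (norm_nonneg _).trans (hM 0 le_rfl)
  refine hstep ⌈2 * l⌉₊ ⟨M, fun t ht => (hM t ht).trans ?_⟩
  gcongr
  linarith [Nat.le_ceil (2 * l)]

end Growth

end SemigroupBound

theorem proposition1p8 {H : Type*} [NormedAddCommGroup H] [InnerProductSpace ℂ H]
    [CompleteSpace H] (S : ℝ → H →L[ℂ] H) (hS : SemigroupBound.IsC0Semigroup S)
    (hr : SemigroupBound.IsResolventRate (SemigroupBound.generator S) 0 1)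
    (m : ℝ → ℝ) (hm_cont : ContinuousOn m (Ici 0)) (hm_pos : ∀ t : ℝ, 0 ≤ t → 0 < m t)
    (hm : ∀ t : ℝ, 0 ≤ t → ‖S t‖ ≤ m t)
    (a b : ℝ) (ha : 0 < a) (hb : 0 < b) :
    ∃ I J : ℝ, IsGLB (SemigroupBound.infValues m a) I ∧
      IsLUB (SemigroupBound.supValues m b) J ∧ 0 < J ∧
      ∀ t : ℝ, a + b ≤ t →
        ‖S t‖ ≤ Real.exp (-(t - a - b)) * (Real.sqrt I / Real.sqrt J) := by
  open SemigroupBound in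
  obtain ⟨d₀, hd₀, hd₀pos⟩ := exists_pos_mem_supValues hm_cont hm_pos hb
  obtain ⟨I, hI⟩ := Real.exists_isGLB (infValues_nonempty (m := m) ha)
    ⟨0, fun _ hc => infValues_nonneg hc⟩
  obtain ⟨J, hJ⟩ := Real.exists_isLUB ⟨d₀, hd₀⟩ (bddAbove_supValues hm_cont hm_pos hb)
  have hJ0 : 0 < J := hd₀pos.trans_le (hJ.1 hd₀)
  have hI0 : 0 ≤ I := hI.2 fun _ hc => infValues_nonneg hc
  refine ⟨I, J, hI, hJ, hJ0, fun t ht => ?_⟩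
  have hR : ∀ z : ℂ, 0 < z.re →
      ∃ R : H →L[ℂ] H, IsResolventAt (generator S) z R ∧ ‖R‖ ≤ 1 := fun z hz => by
    obtain ⟨R, hRz⟩ := hr.exists_resolvent z hz
    exact ⟨R, hRz, by simpa using hr.isLUB.1 ⟨z, R, hz, hRz, rfl⟩⟩
  obtain ⟨M, hM⟩ := exists_bound hS hR hm_cont hm_pos hm
  set K := Real.exp (t - a - b) * ‖S t‖ with hK
  have hK0 : 0 ≤ K := by positivity
  -- the inequality on the lines `Re z = γ > 0` passes to the limit `γ → 0`
  have hcd : ∀ c ∈ infValues m a, ∀ d ∈ supValues m b, K ^ 2 * d ≤ c := fun c hc d hd => by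
    have h1 : Tendsto (fun γ : ℝ => (Real.exp (t - a - b) * (Real.exp (-γ * t) * ‖S t‖)) ^ 2 * d)
        (𝓝[>] 0) (𝓝 (K ^ 2 * d)) := by
      have : Continuous fun γ : ℝ =>
          (Real.exp (t - a - b) * (Real.exp (-γ * t) * ‖S t‖)) ^ 2 * d := by fun_prop
      have h2 := this.tendsto 0
      simp only [neg_zero, zero_mul, Real.exp_zero, one_mul] at h2
      exact h2.mono_left nhdsWithin_le_nhds
    refine le_of_tendsto h1 ?_
    filter_upwards [self_mem_nhdsWithin] with γ hγ
    have hγ0 : 0 < γ := hγ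
    exact exp_mul_norm_sq_mul_le hS hM hγ0 hγ0.le (fun z hz => hR z (by rwa [hz])) hm_cont
      hm_pos hm ha hb ht hc hd
  have hKJ : K ^ 2 * J ≤ I := by
    rcases hK0.eq_or_lt with h | h
    · simpa [← h] using hI0
    · have h2 : 0 < K ^ 2 := by positivity
      rw [mul_comm, ← le_div_iff₀ h2]
      refine hJ.2 fun d hd => ?_
      rw [le_div_iff₀ h2, mul_comm]
      exact hI.2 fun c hc => hcd c hc d hd
  rw [← le_div_iff₀ hJ0] at hKJ
  have h3 := Real.le_sqrt_of_sq_le hKJ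
  rw [Real.sqrt_div hI0] at h3
  calc ‖S t‖ = Real.exp (-(t - a - b)) * K := by
        rw [hK, ← mul_assoc, ← Real.exp_add, neg_add_cancel, Real.exp_zero, one_mul]
    _ ≤ _ := mul_le_mul_of_nonneg_left h3 (Real.exp_pos _).le
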